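/- Let $n\ge 0$ be an integer and let $\Omega=\{x\in\mathbb{R}^{n+1} : x_{n+1}>0\}$. For an open set $U\subseteq\mathbb{R}^{n+1}$ and $j \ge 0$, a current of degree $j$ on $U$ is a continuous $\mathbb{C}$-linear form on the space $\mathcal{D}^{n+1-j}(U)$ of complex-valued $C^\infty$ differential forms of degree $n+1-j$ with compact support in $U$, equipped with its usual LF topology (if $j>n+1$, only the zero current has degree $j$); its exterior derivative is the current $dT$ of degree $j+1$ given by $\langle dT,\varphi\rangle=(-1)^{j+1}\langle T,d\varphi\rangle$. A current $T$ on $\Omega$ is called extensible if there is a current $\check T$ on $\mathbb{R}^{n+1}$ whose restriction to $\Omega$ is $T$. The exterior derivative of an extensible current is extensible; let $\check{H}^j(\Omega)$ be the $j$-th cohomology group of the complex of extensible currents on $\Omega$, that is, the space of $d$-closed extensible currents of degree $j$ modulo the space of currents $dS$ with $S$ an extensible current of degree $j-1$. Then $\check{H}^j(\Omega)=0$ for all $1\le j\le n+1$. In other words, for every $1\le j\le n+1$ and every extensible current $T$ of degree $j$ on $\Omega$ with $dT=0$, there is an extensible current $S$ of degree $j-1$ on $\Omega$ with $dS=T$.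 -/

import Mathlib

open TopologicalSpace
open scoped Distributions

noncomputable section

/-- The space `𝒟^p(Ω)` of complex-valued smooth differential `p`-forms on `ℝ^N` with compact
support contained in the open set `Ω`, with its canonical LF topology. -/
abbrev TestForm {N : ℕ} (Ω : Opens (EuclideanSpace ℝ (Fin N))) (p : ℕ) : Type :=
  𝓓(Ω, EuclideanSpace ℝ (Fin N) [⋀^Fin p]→L[ℝ] ℂ)

namespace TestForm

variable {N : ℕ} {Ω : Opens (EuclideanSpace ℝ (Fin N))} {p : ℕ}

/-- Antisymmetrization `(v ↦ A v) ↦ ((v₀, …, v_p) ↦ ∑ᵢ (-1)ⁱ A vᵢ (v₀, …, v̂ᵢ, …, v_p))`,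
as a `ℂ`-linear continuous map. -/
def alternatizeCLM (N p : ℕ) :
    (EuclideanSpace ℝ (Fin N) →L[ℝ] EuclideanSpace ℝ (Fin N) [⋀^Fin p]→L[ℝ] ℂ) →L[ℂ]
      EuclideanSpace ℝ (Fin N) [⋀^Fin (p + 1)]→L[ℝ] ℂ where
  toFun A := ContinuousAlternatingMap.alternatizeUncurryFin A
  map_add' A B := ContinuousAlternatingMap.alternatizeUncurryFin_add A B
  map_smul' c A := by
    ext v
    simp [ContinuousAlternatingMap.alternatizeUncurryFin_apply, Finset.mul_sum]
  cont := (ContinuousAlternatingMap.alternatizeUncurryFinCLM ℝ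
    (EuclideanSpace ℝ (Fin N)) ℂ).continuous

/-- The exterior derivative `d : 𝒟^p(Ω) → 𝒟^{p+1}(Ω)` on test forms. -/
def d (Ω : Opens (EuclideanSpace ℝ (Fin N))) (p : ℕ) :
    TestForm Ω p →L[ℂ] TestForm Ω (p + 1) :=
  TestFunction.postcompCLM (alternatizeCLM N p) ∘L TestFunction.fderivCLM ℂ ⊤ ⊤

theorem coe_d (φ : TestForm Ω p) : (d Ω p φ : _ → _) = extDeriv φ := by
  ext1 x
  change ContinuousAlternatingMap.alternatizeUncurryFin
    ((TestFunction.fderivCLM ℂ ⊤ ⊤ φ) x) = _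
  rw [TestFunction.fderivCLM_apply_of_le φ (by simp)]
  rfl

theorem d_d (φ : TestForm Ω p) : d Ω (p + 1) (d Ω p φ) = 0 := by
  refine DFunLike.coe_injective ?_
  have h : minSmoothness ℝ 2 ≤ ((⊤ : ℕ∞) : WithTop ℕ∞) := by
    rw [minSmoothness_of_isRCLikeNormedField]
    exact WithTop.coe_le_coe.2 le_top
  rw [coe_d, coe_d, extDeriv_extDeriv φ.contDiff h]
  rfl

/-- Extension by zero `𝒟^p(Ω) → 𝒟^p(ℝ^N)`. -/
def extendByZero (Ω : Opens (EuclideanSpace ℝ (Fin N))) (p : ℕ) :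
    TestForm Ω p →L[ℂ] TestForm (⊤ : Opens (EuclideanSpace ℝ (Fin N))) p :=
  TestFunction.monoCLM ℂ

theorem coe_extendByZero (φ : TestForm Ω p) : (extendByZero Ω p φ : _ → _) = φ := by
  simp [extendByZero]

theorem extendByZero_d (φ : TestForm Ω p) :
    extendByZero Ω (p + 1) (d Ω p φ) = d ⊤ p (extendByZero Ω p φ) := by
  refine DFunLike.coe_injective ?_
  rw [coe_d, coe_extendByZero, coe_extendByZero, coe_d]

end TestForm

/-- The space of (complex) currents of degree `j` on the open set `Ω ⊆ ℝ^N`: continuous linear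
forms on test forms of degree `p` where `p + j = N`. There is one such `p` if `j ≤ N`; if `j > N`
there is none and the space is zero. -/
def Current {N : ℕ} (Ω : Opens (EuclideanSpace ℝ (Fin N))) (j : ℕ) : Type :=
  (p : {p : ℕ // p + j = N}) → (TestForm Ω p.1 →L[ℂ] ℂ)

namespace Current

variable {N : ℕ} (Ω : Opens (EuclideanSpace ℝ (Fin N))) (j : ℕ)

instance : AddCommGroup (Current Ω j) :=
  inferInstanceAs (AddCommGroup ((p : {p : ℕ // p + j = N}) → (TestForm Ω p.1 →L[ℂ] ℂ)))

instance : Module ℂ (Current Ω j) :=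
  inferInstanceAs (Module ℂ ((p : {p : ℕ // p + j = N}) → (TestForm Ω p.1 →L[ℂ] ℂ)))

variable {Ω j}

/-- The value `⟨T, φ⟩` of a current on a test form. -/
def eval (T : Current Ω j) {p : ℕ} (hp : p + j = N) (φ : TestForm Ω p) : ℂ := T ⟨p, hp⟩ φ

theorem ext {S T : Current Ω j}
    (h : ∀ (p : ℕ) (hp : p + j = N) (φ : TestForm Ω p), S.eval hp φ = T.eval hp φ) : S = T :=
  funext fun p => ContinuousLinearMap.ext fun φ => h p.1 p.2 φ

variable (Ω j)

/-- The exterior derivative of currents, `⟨dT, φ⟩ = (-1)^(j+1) ⟨T, dφ⟩` for `T` of degree `j`. -/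
def d : Current Ω j →ₗ[ℂ] Current Ω (j + 1) where
  toFun T p := (-1 : ℂ) ^ (j + 1) • (T ⟨p.1 + 1, by have := p.2; omega⟩ ∘L TestForm.d Ω p.1)
  map_add' S T := ext fun p hp φ => mul_add _ _ _
  map_smul' c T := ext fun p hp φ => mul_left_comm _ _ _

theorem eval_d (T : Current Ω j) {p : ℕ} (hp : p + (j + 1) = N) (φ : TestForm Ω p) :
    (d Ω j T).eval hp φ = (-1) ^ (j + 1) * T.eval (by omega) (TestForm.d Ω p φ) := rfl

theorem d_d (T : Current Ω j) : d Ω (j + 1) (d Ω j T) = 0 := by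
  refine ext fun p hp φ => ?_
  rw [eval_d, eval_d, TestForm.d_d]
  simp [eval]
  rfl

/-- The restriction to `Ω` of a current defined on all of `ℝ^N`. -/
def restrict : Current (⊤ : Opens (EuclideanSpace ℝ (Fin N))) j →ₗ[ℂ] Current Ω j where
  toFun T p := T p ∘L TestForm.extendByZero Ω p.1
  map_add' _ _ := rfl
  map_smul' _ _ := rfl

theorem eval_restrict (T : Current (⊤ : Opens (EuclideanSpace ℝ (Fin N))) j) {p : ℕ}
    (hp : p + j = N) (φ : TestForm Ω p) :
    (restrict Ω j T).eval hp φ = T.eval hp (TestForm.extendByZero Ω p φ) := rfl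

theorem d_restrict (T : Current (⊤ : Opens (EuclideanSpace ℝ (Fin N))) j) :
    d Ω j (restrict Ω j T) = restrict Ω (j + 1) (d ⊤ j T) := by
  refine ext fun p hp φ => ?_
  rw [eval_d, eval_restrict, eval_restrict, eval_d, TestForm.extendByZero_d]

/-- The extensible currents of degree `j` on `Ω`: the restrictions to `Ω` of currents on `ℝ^N`. -/
def extensible : Submodule ℂ (Current Ω j) := LinearMap.range (restrict Ω j)

theorem d_mem_extensible {T : Current Ω j} (hT : T ∈ extensible Ω j) :
    d Ω j T ∈ extensible Ω (j + 1) := by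
  obtain ⟨T', rfl⟩ := hT
  exact ⟨d ⊤ j T', (d_restrict Ω j T').symm⟩

/-- The `d`-closed extensible currents of degree `j`. -/
def cocycles : Submodule ℂ (Current Ω j) := extensible Ω j ⊓ LinearMap.ker (d Ω j)

/-- The currents of degree `j` of the form `dS` with `S` an extensible current of degree `j - 1`
(only `0` if `j = 0`). -/
def coboundaries : (j : ℕ) → Submodule ℂ (Current Ω j)
  | 0 => ⊥
  | j + 1 => (extensible Ω j).map (d Ω j)

theorem coboundaries_le_cocycles : coboundaries Ω j ≤ cocycles Ω j := by
  cases j with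
  | zero => exact bot_le
  | succ j =>
    rintro _ ⟨S, hS, rfl⟩
    exact ⟨d_mem_extensible Ω j hS, d_d Ω j S⟩

/-- The `j`-th de Rham cohomology group of the complex of extensible currents on `Ω`. -/
abbrev ExtensibleCohomology : Type :=
  cocycles Ω j ⧸ (coboundaries Ω j).submoduleOf (cocycles Ω j)

end Current

/-- The open half-space `{x_{n+1} > 0}` of `ℝ^{n+1}`. -/
def halfSpace (n : ℕ) : Opens (EuclideanSpace ℝ (Fin (n + 1))) where
  carrier := {x | 0 < x (Fin.last n)}
  is_open' := isOpen_lt continuous_const (by fun_prop)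

end

/-! The proof is dual: it builds continuous operators `K : 𝒟^{p+1}(ℝ^{n+1}) → 𝒟^p(ℝ^{n+1})` that
preserve support in the half-space and satisfy `dK + Kd = 1` in degrees `p ≤ n`. If `T'` extends
`T`, then `S' = ±T' ∘ K` is a current on the whole space, and testing on forms supported in the
half-space gives `dS = T` there.

For one coordinate, contract with `e = e_i` and integrate along `e` from `-∞`. Compact support is
restored by adding `a(x_i)` times the full line integral, where `a` is `0` for small and `-1` for
large argument (`lineOp`). Cartan's formula and the fundamental theorem of calculus
(`lineOp_homotopy`) show that `1 - dK - Kd` is, up to sign, `dx_i ∧` a line integral of the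
contracted form. Hence its values only have coefficients whose indices include `i`.

Composing the residuals over all coordinates (`residual_comp`, `exists_lowering`) leaves only
coefficients involving all `n + 1` indices, and there are none in degree `p ≤ n`. Support in
`x_{n+1} ≥ b > 0` is kept because the vertical integration runs upward from `-∞` and `a` vanishes
near the boundary. -/

noncomputable section

open MeasureTheory Set

/-! ### Integration along parallel lines -/

section LineIntegral

variable {E : Type} [NormedAddCommGroup E] [NormedSpace ℝ E]
  {F : Type} [NormedAddCommGroup F] [NormedSpace ℝ F]

/-- The weighted integral `x ↦ ∫ f(s) ψ(x - s e) ds` of `ψ` along the lines of direction `e`. -/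
def lineConv (f : ℝ → ℝ) (e : E) (ψ : E → F) (x : E) : F := ∫ s : ℝ, f s • ψ (x - s • e)

variable {f : ℝ → ℝ} {e : E} {ℓ : E →L[ℝ] ℝ} {ψ : E → F}

theorem isClosedEmbedding_smul_of_apply_eq_one (he : ℓ e = 1) :
    Topology.IsClosedEmbedding fun s : ℝ => s • e := by
  have hl : Function.LeftInverse ℓ fun s : ℝ => s • e := fun s => by simp [he]
  exact hl.isClosedEmbedding ℓ.continuous (by fun_prop)

theorem isLocallyFiniteMeasure_map_smul [MeasurableSpace E] [BorelSpace E] (he : ℓ e = 1) :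
    IsLocallyFiniteMeasure ((volume : Measure ℝ).map fun s : ℝ => s • e) := by
  have hemb := (isClosedEmbedding_smul_of_apply_eq_one he).measurableEmbedding
  refine ⟨fun x => ⟨ℓ ⁻¹' Metric.ball (ℓ x) 1, ?_, ?_⟩⟩
  · exact (Metric.isOpen_ball.preimage ℓ.continuous).mem_nhds (by simp)
  · rw [hemb.map_apply]
    have : (fun s : ℝ => s • e) ⁻¹' (ℓ ⁻¹' Metric.ball (ℓ x) 1) = Metric.ball (ℓ x) 1 := by
      ext s; simp [he]
    rw [this]
    exact measure_ball_lt_top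

/-- Smoothness is inherited from convolution with the locally finite measure carried by the line
`ℝe`; `ℓ` recovers the parameter on that line. -/
theorem lineConv_eq_convolution [MeasurableSpace E] [BorelSpace E] (he : ℓ e = 1) :
    lineConv f e ψ = convolution (fun t => f (ℓ t)) ψ (ContinuousLinearMap.lsmul ℝ ℝ)
      ((volume : Measure ℝ).map fun s : ℝ => s • e) := by
  have hemb := (isClosedEmbedding_smul_of_apply_eq_one he).measurableEmbedding
  ext x
  rw [convolution, hemb.integral_map]
  simp [lineConv, he]

theorem locallyIntegrable_comp_of_norm_le_one [MeasurableSpace E] [BorelSpace E] {μ : Measure E}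
    [IsLocallyFiniteMeasure μ] (hf : Measurable f) (hf1 : ∀ s, ‖f s‖ ≤ 1) :
    LocallyIntegrable (fun t => f (ℓ t)) μ := by
  refine (locallyIntegrable_const (1 : ℝ)).mono
    (hf.comp ℓ.continuous.measurable).aestronglyMeasurable (.of_forall fun t => ?_)
  simpa using hf1 (ℓ t)

theorem contDiff_lineConv (he : ℓ e = 1) (hf : Measurable f) (hf1 : ∀ s, ‖f s‖ ≤ 1)
    (hc : HasCompactSupport ψ) {n : ℕ∞} (hψ : ContDiff ℝ n ψ) : ContDiff ℝ n (lineConv f e ψ) := by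
  borelize E
  have := isLocallyFiniteMeasure_map_smul he
  rw [lineConv_eq_convolution he]
  exact hc.contDiff_convolution_right _ (locallyIntegrable_comp_of_norm_le_one hf hf1) hψ

theorem hasCompactSupport_comp_line {G : Type} [NormedAddCommGroup G] {ψ : E → G}
    (he : ℓ e = 1) (hc : HasCompactSupport ψ) (x : E) :
    HasCompactSupport fun s : ℝ => ψ (x - s • e) :=
  hc.comp_isClosedEmbedding ((Homeomorph.subLeft x).isClosedEmbedding.comp
    (isClosedEmbedding_smul_of_apply_eq_one he))

theorem integrable_lineConv (he : ℓ e = 1) (hf : Measurable f) (hf1 : ∀ s, ‖f s‖ ≤ 1)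
    (hc : HasCompactSupport ψ) (hψ : Continuous ψ) (x : E) :
    Integrable fun s : ℝ => f s • ψ (x - s • e) := by
  have h : Integrable fun s : ℝ => ψ (x - s • e) :=
    Continuous.integrable_of_hasCompactSupport (by fun_prop) (hasCompactSupport_comp_line he hc x)
  exact h.bdd_smul 1 hf.aestronglyMeasurable (.of_forall hf1)

theorem hasFDerivAt_lineConv (he : ℓ e = 1) (hf : Measurable f) (hf1 : ∀ s, ‖f s‖ ≤ 1)
    (hc : HasCompactSupport ψ) (hψ : ContDiff ℝ 1 ψ) (x : E) :
    HasFDerivAt (lineConv f e ψ) (lineConv f e (fderiv ℝ ψ) x) x := by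
  have hc' := hc.fderiv ℝ
  have hψ' := hψ.continuous_fderiv one_ne_zero
  obtain ⟨C, hC⟩ := hψ'.bounded_above_of_compact_support hc'
  obtain ⟨B, hB⟩ := IsCompact.exists_bound_of_continuousOn hc' ℓ.continuous.continuousOn
  refine hasFDerivAt_integral_of_dominated_of_fderiv_le
    (s := ℓ ⁻¹' Metric.ball (ℓ x) 1)
    -- For `y` with `|ℓ y - ℓ x| < 1`, the integrand vanishes unless `|ℓ y - s| ≤ B`, so `s` stays
    -- within `B + 1` of `ℓ x`.
    (bound := indicator (Icc (ℓ x - B - 1) (ℓ x + B + 1)) fun _ => C)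
    (F' := fun y s => f s • fderiv ℝ ψ (y - s • e))
    ((Metric.isOpen_ball.preimage ℓ.continuous).mem_nhds (by simp))
    (.of_forall fun y => (integrable_lineConv he hf hf1 hc hψ.continuous y).aestronglyMeasurable)
    (integrable_lineConv he hf hf1 hc hψ.continuous x)
    (integrable_lineConv he hf hf1 hc' hψ' x).aestronglyMeasurable
    (.of_forall fun s y hy => ?_)
    ((integrable_indicator_iff measurableSet_Icc).2 (integrableOn_const measure_Icc_lt_top.ne))
    (.of_forall fun s y _ => ?_)
  · by_cases hs : y - s • e ∈ tsupport (fderiv ℝ ψ)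
    · have h := abs_le.1 (hB _ hs)
      have hy' := abs_lt.1 (show |ℓ y - ℓ x| < 1 from hy)
      simp only [map_sub, map_smul, he, smul_eq_mul, mul_one] at h
      rw [indicator_of_mem (by constructor <;> linarith), norm_smul]
      exact (mul_le_of_le_one_left (norm_nonneg _) (hf1 s)).trans (hC _)
    · rw [image_eq_zero_of_notMem_tsupport hs, smul_zero, norm_zero]
      exact indicator_nonneg (fun _ _ => (norm_nonneg _).trans (hC 0)) s
  · have h := ((hψ.differentiable one_ne_zero) (y - s • e)).hasFDerivAt.comp y
      ((hasFDerivAt_id y).sub_const (s • e))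
    exact h.const_smul (f s)

theorem norm_lineConv_le (he : ℓ e = 1) (hf1 : ∀ s, ‖f s‖ ≤ 1) {B C : ℝ} (hB : 0 ≤ B)
    (hsupp : ∀ y, B < |ℓ y| → ψ y = 0) (hC : ∀ y, ‖ψ y‖ ≤ C) (x : E) :
    ‖lineConv f e ψ x‖ ≤ 2 * B * C := by
  have hz : ∀ s ∉ Icc (ℓ x - B) (ℓ x + B), f s • ψ (x - s • e) = 0 := by
    intro s hs
    rw [hsupp, smul_zero]
    rw [map_sub, map_smul, he, smul_eq_mul, mul_one]
    by_contra! h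
    rw [abs_le] at h
    exact hs ⟨by linarith, by linarith⟩
  rw [lineConv, ← setIntegral_eq_integral_of_forall_compl_eq_zero hz]
  refine (norm_setIntegral_le_of_norm_le_const (C := C) measure_Icc_lt_top fun s _ => ?_).trans ?_
  · rw [norm_smul]
    exact (mul_le_of_le_one_left (norm_nonneg _) (hf1 s)).trans (hC _)
  · rw [Real.volume_real_Icc_of_le (by linarith)]
    linarith

/-- The indicator of the positive half-line. -/
def heaviside : ℝ → ℝ := indicator (Ioi 0) 1

theorem measurable_heaviside : Measurable heaviside := measurable_one.indicator measurableSet_Ioi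

theorem norm_heaviside_le (s : ℝ) : ‖heaviside s‖ ≤ 1 := by
  rw [heaviside, indicator_apply]; split_ifs <;> simp

theorem heaviside_of_pos {s : ℝ} (hs : 0 < s) : heaviside s = 1 := by simp [heaviside, hs]

theorem heaviside_of_nonpos {s : ℝ} (hs : s ≤ 0) : heaviside s = 0 := by simp [heaviside, hs]

/-- The operator `ψ ↦ c ∫_{s>0} ψ(x - s e) ds + a(ℓ x) ∫_ℝ ψ(x - s e) ds`. -/
def lineOp (c : ℝ) (a : ℝ → ℝ) (ℓ : E →L[ℝ] ℝ) (e : E) (ψ : E → F) (x : E) : F :=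
  c • lineConv heaviside e ψ x + a (ℓ x) • lineConv 1 e ψ x

variable {c : ℝ} {a : ℝ → ℝ}

theorem contDiff_lineOp (he : ℓ e = 1) {n : ℕ∞} (ha : ContDiff ℝ n a)
    (hc : HasCompactSupport ψ) (hψ : ContDiff ℝ n ψ) : ContDiff ℝ n (lineOp c a ℓ e ψ) :=
  ((contDiff_lineConv he measurable_heaviside norm_heaviside_le hc hψ).const_smul c).add
    ((ha.comp ℓ.contDiff).smul (contDiff_lineConv he measurable_one (by simp) hc hψ))

/-- The product rule differentiates `ψ` or `a`. The second term is again a `lineOp`, with parameters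
`(0, a')`, so the family is stable under differentiation. -/
theorem fderiv_lineOp (he : ℓ e = 1) (ha : ContDiff ℝ 1 a)
    (hc : HasCompactSupport ψ) (hψ : ContDiff ℝ 1 ψ) :
    fderiv ℝ (lineOp c a ℓ e ψ) = fun x => lineOp c a ℓ e (fderiv ℝ ψ) x +
      ContinuousLinearMap.smulRightL ℝ E F ℓ (lineOp 0 (deriv a) ℓ e ψ x) := by
  ext1 x
  have hJ := hasFDerivAt_lineConv he measurable_heaviside norm_heaviside_le hc hψ x
  have hI := hasFDerivAt_lineConv (f := 1) he measurable_one (by simp) hc hψ x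
  have haℓ : HasFDerivAt (fun x => a (ℓ x)) (deriv a (ℓ x) • ℓ) x :=
    ((ha.differentiable one_ne_zero) (ℓ x)).hasDerivAt.comp_hasFDerivAt x ℓ.hasFDerivAt
  have h := ((hJ.const_smul c).add (haℓ.smul hI)).fderiv
  refine h.trans ?_
  ext v
  simp [lineOp, smul_smul, add_assoc]

theorem lineOp_comp [CompleteSpace F] {F' : Type} [NormedAddCommGroup F'] [NormedSpace ℝ F']
    [CompleteSpace F'] (he : ℓ e = 1) (hc : HasCompactSupport ψ) (hψ : Continuous ψ)
    (L : F →L[ℝ] F') (x : E) :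
    lineOp c a ℓ e (fun y => L (ψ y)) x = L (lineOp c a ℓ e ψ x) := by
  simp only [lineOp, lineConv, map_add, map_smul]
  rw [← L.integral_comp_comm (integrable_lineConv he measurable_heaviside norm_heaviside_le hc hψ x),
    ← L.integral_comp_comm (integrable_lineConv he measurable_one (by simp) hc hψ x)]
  simp

theorem lineOp_add (he : ℓ e = 1) {φ : E → F} (hcφ : HasCompactSupport φ) (hφ : Continuous φ)
    (hcψ : HasCompactSupport ψ) (hψ : Continuous ψ) (x : E) :
    lineOp c a ℓ e (φ + ψ) x = lineOp c a ℓ e φ x + lineOp c a ℓ e ψ x := by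
  have key : ∀ f : ℝ → ℝ, Measurable f → (∀ s, ‖f s‖ ≤ 1) →
      lineConv f e (φ + ψ) x = lineConv f e φ x + lineConv f e ψ x := fun f hf hf1 => by
    simp only [lineConv, Pi.add_apply, smul_add]
    exact integral_add (integrable_lineConv he hf hf1 hcφ hφ x)
      (integrable_lineConv he hf hf1 hcψ hψ x)
  simp only [lineOp, key _ measurable_heaviside norm_heaviside_le, key 1 measurable_one (by simp),
    smul_add]
  abel

theorem lineOp_smul {𝕜 : Type} [RCLike 𝕜] [NormedSpace 𝕜 F] [SMulCommClass ℝ 𝕜 F]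
    (z : 𝕜) (x : E) : lineOp c a ℓ e (z • ψ) x = z • lineOp c a ℓ e ψ x := by
  have key : ∀ f : ℝ → ℝ, lineConv f e (z • ψ) x = z • lineConv f e ψ x := fun f => by
    simp only [lineConv, Pi.smul_apply, smul_comm _ z]
    exact integral_smul z _
  simp only [lineOp, key, smul_add, smul_comm _ z]

theorem lineConv_eq_zero {x : E} (h : ∀ s, f s ≠ 0 → ψ (x - s • e) = 0) :
    lineConv f e ψ x = 0 := by
  refine integral_eq_zero_of_ae (.of_forall fun s => ?_)
  by_cases hs : f s = 0
  · simp [hs]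
  · simp [h s hs]

theorem lineOp_eq_zero_of_line {x : E} (h : ∀ s : ℝ, ψ (x - s • e) = 0) :
    lineOp c a ℓ e ψ x = 0 := by
  rw [lineOp, lineConv_eq_zero fun s _ => h s, lineConv_eq_zero fun s _ => h s]
  simp

/-- The half-line integral at `x` only sees points lower than `x`. This keeps supports away from the
boundary of the half-space. -/
theorem lineOp_eq_zero_of_lt (he : ℓ e = 1) {b : ℝ} {x : E} (ha : a (ℓ x) = 0)
    (h : ∀ y, ℓ y < b → ψ y = 0) (hx : ℓ x < b) : lineOp c a ℓ e ψ x = 0 := by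
  rw [lineOp, ha, zero_smul, add_zero, lineConv_eq_zero, smul_zero]
  intro s hs
  refine h _ ?_
  have : 0 < s := by
    by_contra! h
    exact hs (heaviside_of_nonpos h)
  simp [he]
  linarith

/-- Above the support of `ψ`, the half-line integral equals the full one, and the weight `-c`
cancels it. -/
theorem lineOp_eq_zero_of_gt (he : ℓ e = 1) {b : ℝ} {x : E} (ha : a (ℓ x) = -c)
    (h : ∀ y, b < ℓ y → ψ y = 0) (hx : b < ℓ x) : lineOp c a ℓ e ψ x = 0 := by
  have : lineConv heaviside e ψ x = lineConv 1 e ψ x := by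
    refine integral_congr_ae (.of_forall fun s => ?_)
    rcases lt_or_ge 0 s with hs | hs
    · simp [heaviside_of_pos hs]
    · have : ψ (x - s • e) = 0 := h _ (by simp [he]; linarith)
      simp [this]
  rw [lineOp, ha, this, neg_smul, add_neg_cancel]

/-- The compact set swept by `K` when translated by `s e`, `|s| ≤ B`. -/
def sweep (e : E) (K : Compacts E) (B : ℝ) : Compacts E :=
  ⟨(fun q : E × ℝ => q.1 + q.2 • e) '' ((K : Set E) ×ˢ Icc (-B) B),
    (K.isCompact.prod isCompact_Icc).image (by fun_prop)⟩

/-- `B ≥ 2` puts the transition zone of `a` inside `|ℓ| ≤ B`. A point with `|ℓ x| ≤ B` whose line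
meets `K` lies within parameter distance `2 * B` of `K`. -/
theorem lineOp_eq_zero_of_notMem_sweep (he : ℓ e = 1) (ha₀ : ∀ y ≤ 1, a y = 0)
    (ha₁ : ∀ y, 2 ≤ y → a y = -c) {K : Compacts E} {B : ℝ} (hB : 2 ≤ B)
    (hK : ∀ y ∈ K, |ℓ y| ≤ B) (hψ : ∀ y ∉ K, ψ y = 0) {x : E} (hx : x ∉ sweep e K (2 * B)) :
    lineOp c a ℓ e ψ x = 0 := by
  rcases lt_or_ge (ℓ x) (-B) with h₁ | h₁
  · refine lineOp_eq_zero_of_lt he (ha₀ _ (by linarith)) (fun y hy => hψ y fun hyK => ?_) h₁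
    have := abs_le.1 (hK y hyK)
    linarith
  rcases lt_or_ge B (ℓ x) with h₂ | h₂
  · refine lineOp_eq_zero_of_gt he (ha₁ _ (by linarith)) (fun y hy => hψ y fun hyK => ?_) h₂
    have := abs_le.1 (hK y hyK)
    linarith
  refine lineOp_eq_zero_of_line fun s => hψ _ fun hs => hx ?_
  have := abs_le.1 (hK _ hs)
  simp only [map_sub, map_smul, he, smul_eq_mul, mul_one] at this
  exact ⟨(x - s • e, s), ⟨hs, by constructor <;> linarith⟩, by simp⟩

theorem exists_bound_compacts (ℓ : E →L[ℝ] ℝ) (K : Compacts E) :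
    ∃ B : ℝ, 2 ≤ B ∧ ∀ y ∈ K, |ℓ y| ≤ B := by
  obtain ⟨C, hC⟩ := K.isCompact.exists_bound_of_continuousOn ℓ.continuous.continuousOn
  exact ⟨max 2 C, le_max_left _ _, fun y hy => (hC y hy).trans (le_max_right _ _)⟩

/-- By the fundamental theorem of calculus, the half-line integral of `∂_e ψ` is `ψ x` and the full
line integral is `0`. -/
theorem lineOp_fderiv_apply [CompleteSpace F] (he : ℓ e = 1) (hc : HasCompactSupport ψ)
    (hψ : ContDiff ℝ 1 ψ) (x : E) :
    lineOp c a ℓ e (fun y => fderiv ℝ ψ y e) x = c • ψ x := by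
  set g : ℝ → F := fun s => ψ (x - s • e) with hg
  have hgc : HasCompactSupport g := hasCompactSupport_comp_line he hc x
  have hg1 : ContDiff ℝ 1 g := hψ.comp (by fun_prop)
  have hd : ∀ s, deriv g s = -fderiv ℝ ψ (x - s • e) e := fun s => by
    have h₁ : HasDerivAt (fun s : ℝ => x - s • e) (-e) s := by
      simpa using ((hasDerivAt_id s).smul_const e).const_sub x
    have h₂ := ((hψ.differentiable one_ne_zero) (x - s • e)).hasFDerivAt.comp_hasDerivAt s h₁
    exact h₂.deriv.trans (map_neg _ _)
  have hJ : lineConv heaviside e (fun y => fderiv ℝ ψ y e) x = ψ x := by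
    have h := hgc.integral_Ioi_deriv_eq hg1 0
    simp only [hd, integral_neg, neg_inj] at h
    rw [show ψ x = g 0 by simp [hg], ← h, ← integral_indicator measurableSet_Ioi]
    refine integral_congr_ae (.of_forall fun s => ?_)
    simp [heaviside, indicator_apply]
  have hI : lineConv 1 e (fun y => fderiv ℝ ψ y e) x = 0 := by
    have h := integral_eq_zero_of_hasDerivAt_of_integrable
      (fun s => (hg1.differentiable one_ne_zero s).hasDerivAt)
      ((hg1.continuous_deriv le_rfl).integrable_of_hasCompactSupport hgc.deriv)
      (hg1.continuous.integrable_of_hasCompactSupport hgc)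
    simp only [hd, integral_neg, neg_eq_zero] at h
    simpa [lineConv] using h
  rw [lineOp, hJ, hI, smul_zero, add_zero]

end LineIntegral
end

/-! ### Continuity on test functions -/

noncomputable section

open MeasureTheory Set

section TestFunctionOperator

variable {E : Type} [NormedAddCommGroup E] [NormedSpace ℝ E] {ℓ : E →L[ℝ] ℝ} {e : E}

/-- The induction on `k` must quantify over `F`, `c` and `a`, since one derivative replaces them by
`E →L[ℝ] F` or by `(0, a')`. Restricting to `K₂` bounds `a ∘ ℓ`. -/
theorem norm_iteratedFDeriv_lineOp_le (he : ℓ e = 1) (K₁ K₂ : Compacts E) (k : ℕ) :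
    ∀ (F : Type) [NormedAddCommGroup F] [NormedSpace ℝ F] (c : ℝ) (a : ℝ → ℝ),
      ContDiff ℝ (⊤ : ℕ∞) a → ∃ C : ℝ, 0 ≤ C ∧ ∀ ψ : 𝓓_{K₁}(E, F), ∀ x ∈ K₂,
        ‖iteratedFDeriv ℝ k (lineOp c a ℓ e ψ) x‖ ≤
          C * ((Finset.range (k + 1)).sup fun j => N[ℝ]_{K₁, ⊤, j}) ψ := by
  induction k with
  | zero =>
    intro F _ _ c a ha
    obtain ⟨B, hB, hBK⟩ := exists_bound_compacts ℓ K₁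
    obtain ⟨D, hD⟩ := K₂.isCompact.exists_bound_of_continuousOn
      (ha.continuous.comp ℓ.continuous).continuousOn
    refine ⟨(|c| + |D|) * (2 * B), by positivity, fun ψ x hx => ?_⟩
    have hsupp : ∀ y, B < |ℓ y| → ψ y = 0 := fun y hy =>
      ψ.zero_on_compl fun hyK => absurd (hBK y hyK) (not_le.2 hy)
    have hN : ∀ y, ‖ψ y‖ ≤ N[ℝ]_{K₁, ⊤, 0} ψ := fun y =>
      ContDiffMapSupportedIn.norm_apply_le_seminorm ℝ
    have h₁ := norm_lineConv_le he norm_heaviside_le (by linarith) hsupp hN x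
    have h₂ := norm_lineConv_le (f := 1) he (by simp) (by linarith) hsupp hN x
    rw [norm_iteratedFDeriv_zero]
    simp only [zero_add, Finset.range_one, Finset.sup_singleton]
    calc ‖lineOp c a ℓ e ψ x‖
        ≤ |c| * ‖lineConv heaviside e ψ x‖ + |a (ℓ x)| * ‖lineConv 1 e ψ x‖ := by
          refine (norm_add_le _ _).trans ?_
          rw [norm_smul, norm_smul, Real.norm_eq_abs, Real.norm_eq_abs]
      _ ≤ |c| * (2 * B * N[ℝ]_{K₁, ⊤, 0} ψ) + |D| * (2 * B * N[ℝ]_{K₁, ⊤, 0} ψ) := by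
          have hDx : |a (ℓ x)| ≤ |D| := (hD x hx).trans (le_abs_self D)
          exact add_le_add (by gcongr) (mul_le_mul hDx h₂ (norm_nonneg _) (abs_nonneg _))
      _ = _ := by ring
  | succ k ih =>
    intro F _ _ c a ha
    have ha' : ContDiff ℝ (⊤ : ℕ∞) (deriv a) := ha.iterate_deriv 1
    obtain ⟨C₁, hC₁, h₁⟩ := ih (E →L[ℝ] F) c a ha
    obtain ⟨C₂, hC₂, h₂⟩ := ih F 0 (deriv a) ha'
    set L := ContinuousLinearMap.smulRightL ℝ E F ℓ with hL
    refine ⟨C₁ + ‖L‖ * C₂, by positivity, fun ψ x hx => ?_⟩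
    set ψ' : 𝓓_{K₁}(E, E →L[ℝ] F) := ContDiffMapSupportedIn.fderivLM ℝ ⊤ ⊤ ψ with hψ'
    have hcoe : (ψ' : E → E →L[ℝ] F) = fderiv ℝ ψ := by
      rw [hψ', ContDiffMapSupportedIn.fderivLM_apply_of_le]; simp
    set S := ((Finset.range (k + 1 + 1)).sup fun j => N[ℝ; F]_{K₁, ⊤, j}) ψ with hS
    have hS₂ : ((Finset.range (k + 1)).sup fun j => N[ℝ; F]_{K₁, ⊤, j}) ψ ≤ S :=
      Finset.sup_mono (f := fun j => N[ℝ; F]_{K₁, ⊤, j})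
        (Finset.range_mono (Nat.le_succ _)) ψ
    have hS₁ : ((Finset.range (k + 1)).sup fun j => N[ℝ; E →L[ℝ] F]_{K₁, ⊤, j}) ψ' ≤ S := by
      refine Seminorm.finset_sup_apply_le (apply_nonneg _ _) fun j hj => ?_
      rw [hψ', ContDiffMapSupportedIn.seminorm_fderivLM_top]
      exact Finset.le_sup (f := fun j => N[ℝ; F]_{K₁, ⊤, j})
        (Finset.mem_range.2 (Nat.succ_lt_succ (Finset.mem_range.1 hj))) ψ
    have hsm₁ : ContDiff ℝ (⊤ : ℕ∞) (lineOp c a ℓ e ψ') :=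
      contDiff_lineOp he ha ψ'.hasCompactSupport ψ'.contDiff
    have hsm₂ : ContDiff ℝ (⊤ : ℕ∞) (lineOp 0 (deriv a) ℓ e ψ) :=
      contDiff_lineOp he ha' ψ.hasCompactSupport ψ.contDiff
    have hk : (k : WithTop ℕ∞) ≤ ((⊤ : ℕ∞) : WithTop ℕ∞) := by exact_mod_cast le_top
    have h1 : (1 : WithTop ℕ∞) ≤ ((⊤ : ℕ∞) : WithTop ℕ∞) := by exact_mod_cast le_top
    rw [← norm_iteratedFDeriv_fderiv, fderiv_lineOp he (ha.of_le h1) ψ.hasCompactSupport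
      (ψ.contDiff.of_le h1), ← hcoe]
    have hadd := iteratedFDeriv_add_apply (𝕜 := ℝ) (i := k) (x := x)
      (hsm₁.of_le hk).contDiffAt ((L.contDiff.comp hsm₂).of_le hk).contDiffAt
    refine (congrArg norm hadd).trans_le ((norm_add_le _ _).trans ?_)
    rw [add_mul]
    refine add_le_add ((h₁ ψ' x hx).trans (by gcongr)) ?_
    refine (L.norm_iteratedFDeriv_comp_left (hsm₂.of_le hk).contDiffAt le_rfl).trans ?_
    rw [mul_assoc]
    gcongr
    exact (h₂ ψ x hx).trans (by gcongr)

variable {F : Type} [NormedAddCommGroup F] [NormedSpace ℝ F] [NormedSpace ℂ F]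
  [IsScalarTower ℝ ℂ F]

variable (F) in
-- Continuity for the LF topology is checked on each `𝓓_K`, whose image is supported in one fixed
-- swept compact.
theorem exists_lineOpCLM (he : ℓ e = 1) {c : ℝ} {a : ℝ → ℝ} (ha : ContDiff ℝ (⊤ : ℕ∞) a)
    (ha₀ : ∀ y ≤ 1, a y = 0) (ha₁ : ∀ y, 2 ≤ y → a y = -c) :
    ∃ M : 𝓓((⊤ : Opens E), F) →L[ℂ] 𝓓((⊤ : Opens E), F),
      ∀ ψ, (M ψ : E → F) = lineOp c a ℓ e ψ := by
  choose B hB hBK using exists_bound_compacts ℓ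
  have hz : ∀ (K : Compacts E) (ψ : E → F), (∀ y ∉ K, ψ y = 0) →
      ∀ x ∉ sweep e K (2 * B K), lineOp c a ℓ e ψ x = 0 := fun K ψ hψ x hx =>
    lineOp_eq_zero_of_notMem_sweep he ha₀ ha₁ (hB K) (hBK K) hψ hx
  let Φ (ψ : 𝓓((⊤ : Opens E), F)) : 𝓓((⊤ : Opens E), F) :=
    ⟨lineOp c a ℓ e ψ, contDiff_lineOp he ha ψ.hasCompactSupport ψ.contDiff,
      HasCompactSupport.intro (sweep e ⟨tsupport ψ, ψ.hasCompactSupport⟩ _).isCompact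
        (hz ⟨tsupport ψ, ψ.hasCompactSupport⟩ ψ fun y hy => image_eq_zero_of_notMem_tsupport hy),
      subset_univ _⟩
  let T (K : Compacts E) : 𝓓_{K}(E, F) →L[ℂ] 𝓓_{sweep e K (2 * B K)}(E, F) :=
    ContDiffMapSupportedIn.mkCLM ℂ (fun ψ => lineOp c a ℓ e ψ)
      (fun φ ψ x => lineOp_add he φ.hasCompactSupport φ.continuous ψ.hasCompactSupport
        ψ.continuous x)
      (fun z ψ x => lineOp_smul z x)
      (fun ψ => contDiff_lineOp he ha ψ.hasCompactSupport ψ.contDiff)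
      (fun ψ x hx => hz K ψ (fun y hy => ψ.zero_on_compl hy) x hx)
      (fun k _ => by
        obtain ⟨C, hC, h⟩ := norm_iteratedFDeriv_lineOp_le he K (sweep e K (2 * B K)) k F c a ha
        refine ⟨Finset.range (k + 1), C, hC, fun ψ x hx => (h ψ x hx).trans_eq ?_⟩
        congr 1
        simp only [Seminorm.finset_sup_apply]
        rfl)
  exact ⟨TestFunction.limitCLM ℂ Φ
    (fun K hK => TestFunction.ofSupportedInCLM ℂ (subset_univ _) ∘L T K)
    (fun _ _ _ => rfl), fun _ => rfl⟩

/-- The operator `lineOp` on test functions. -/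
def lineOpCLM (F : Type) [NormedAddCommGroup F] [NormedSpace ℝ F] [NormedSpace ℂ F]
    [IsScalarTower ℝ ℂ F] (he : ℓ e = 1) {c : ℝ} {a : ℝ → ℝ} (ha : ContDiff ℝ (⊤ : ℕ∞) a)
    (ha₀ : ∀ y ≤ 1, a y = 0) (ha₁ : ∀ y, 2 ≤ y → a y = -c) :
    𝓓((⊤ : Opens E), F) →L[ℂ] 𝓓((⊤ : Opens E), F) :=
  (exists_lineOpCLM F he ha ha₀ ha₁).choose

theorem coe_lineOpCLM (he : ℓ e = 1) {c : ℝ} {a : ℝ → ℝ} (ha : ContDiff ℝ (⊤ : ℕ∞) a)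
    (ha₀ : ∀ y ≤ 1, a y = 0) (ha₁ : ∀ y, 2 ≤ y → a y = -c) (ψ : 𝓓((⊤ : Opens E), F)) :
    (lineOpCLM F he ha ha₀ ha₁ ψ : E → F) = lineOp c a ℓ e ψ :=
  (exists_lineOpCLM F he ha ha₀ ha₁).choose_spec ψ

end TestFunctionOperator
end

/-! ### Cartan's formula and the homotopy along one coordinate -/

noncomputable section

open MeasureTheory Set

namespace ContinuousAlternatingMap

variable {E : Type} [NormedAddCommGroup E] [NormedSpace ℝ E] {p : ℕ}

/-- The contraction `ω ↦ ω(e, ·)` of alternating forms, as a `ℂ`-linear continuous map. -/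
def contractCLM (e : E) (p : ℕ) : (E [⋀^Fin (p + 1)]→L[ℝ] ℂ) →L[ℂ] E [⋀^Fin p]→L[ℝ] ℂ where
  toFun ω := ω.curryLeft e
  map_add' _ _ := rfl
  map_smul' _ _ := rfl
  cont := (ContinuousLinearMap.apply ℝ (E [⋀^Fin p]→L[ℝ] ℂ) e).continuous.comp
    (curryLeftLI (𝕜 := ℝ) (E := E) (F := ℂ) (n := p)).continuous

theorem contractCLM_apply (e : E) (ω : E [⋀^Fin (p + 1)]→L[ℝ] ℂ) (v : Fin p → E) :
    contractCLM e p ω v = ω (Matrix.vecCons e v) := rfl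

/-- Cartan's formula at the level of symbols. -/
theorem alternatizeUncurryFin_contract_add (e : E) (A : E →L[ℝ] E [⋀^Fin (p + 1)]→L[ℝ] ℂ) :
    alternatizeUncurryFin (((contractCLM e p).restrictScalars ℝ).comp A) +
      contractCLM e (p + 1) (alternatizeUncurryFin A) = A e := by
  ext v
  -- The term of index `0` in the second sum is `A e v`; the others, shifted by one and so of
  -- opposite sign, cancel the first sum.
  rw [add_apply, contractCLM_apply, alternatizeUncurryFin_apply, alternatizeUncurryFin_apply,
    Fin.sum_univ_succ (n := p + 1), ← add_assoc, add_right_comm, ← Finset.sum_add_distrib,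
    Finset.sum_eq_zero, zero_add]
  · simp
  intro i _
  have : i.succ.removeNth (Matrix.vecCons e v) = Matrix.vecCons e (i.removeNth v) :=
    funext (Fin.cases (by simp [Fin.removeNth]) fun j => by simp [Fin.removeNth])
  simp [this, contractCLM_apply, pow_succ]

theorem contract_alternatizeUncurryFin_zero (e : E) (A : E →L[ℝ] E [⋀^Fin 0]→L[ℝ] ℂ) :
    contractCLM e 0 (alternatizeUncurryFin A) = A e := by
  ext v
  rw [contractCLM_apply, alternatizeUncurryFin_apply]
  simp [Subsingleton.elim _ v]

end ContinuousAlternatingMap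

open ContinuousAlternatingMap

/-- The abstract homotopy formula for `lineOp`, where `alt` and `alt'` play the role of
antisymmetrizations, and `ι` and `κ` that of contractions with `e`. -/
theorem lineOp_homotopy_of_cartan {E F G H : Type} [NormedAddCommGroup E] [NormedSpace ℝ E]
    [NormedAddCommGroup F] [NormedSpace ℝ F] [CompleteSpace F] [NormedAddCommGroup G]
    [NormedSpace ℝ G] [CompleteSpace G] [NormedAddCommGroup H] [NormedSpace ℝ H]
    {ℓ : E →L[ℝ] ℝ} {e : E} (he : ℓ e = 1) {a : ℝ → ℝ} (ha : ContDiff ℝ 1 a)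
    {φ : E → F} (hc : HasCompactSupport φ) (hφ : ContDiff ℝ 1 φ)
    (ι : F →L[ℝ] G) (κ : H →L[ℝ] F) (alt : (E →L[ℝ] G) →L[ℝ] F) (alt' : (E →L[ℝ] F) →L[ℝ] H)
    (cartan : ∀ A : E →L[ℝ] F, alt (ι.comp A) + κ (alt' A) = A e) (x : E) :
    alt (fderiv ℝ (lineOp 1 a ℓ e fun y => ι (φ y)) x) +
      lineOp 1 a ℓ e (fun y => κ (alt' (fderiv ℝ φ y))) x =
    φ x + alt (ℓ.smulRight (lineOp 0 (deriv a) ℓ e (fun y => ι (φ y)) x)) := by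
  set ψ : E → G := fun y => ι (φ y) with hψ
  have hψc : HasCompactSupport ψ := hc.comp_left (map_zero ι)
  have hψ1 : ContDiff ℝ 1 ψ := ι.contDiff.comp hφ
  have hψ' : ∀ y, fderiv ℝ ψ y = ι.comp (fderiv ℝ φ y) := fun y =>
    (ι.hasFDerivAt.comp y (hφ.differentiable one_ne_zero y).hasFDerivAt).fderiv
  have hdc := hψc.fderiv ℝ
  have hdψ := hψ1.continuous_fderiv one_ne_zero
  have h₁ : alt (fderiv ℝ (lineOp 1 a ℓ e ψ) x) = lineOp 1 a ℓ e (fun y => alt (fderiv ℝ ψ y)) x +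
      alt (ℓ.smulRight (lineOp 0 (deriv a) ℓ e ψ x)) := by
    rw [fderiv_lineOp he ha hψc hψ1, lineOp_comp he hdc hdψ, map_add]
    rfl
  have hsum : ((fun y => alt (fderiv ℝ ψ y)) + fun y => κ (alt' (fderiv ℝ φ y))) =
      fun y => fderiv ℝ φ y e := by
    ext1 y
    rw [Pi.add_apply, hψ', cartan]
  have hc₁ : HasCompactSupport fun y => alt (fderiv ℝ ψ y) := hdc.comp_left (map_zero alt)
  have hc₂ : HasCompactSupport fun y => κ (alt' (fderiv ℝ φ y)) :=
    (hc.fderiv ℝ).comp_left (g := fun A => κ (alt' A)) (by simp)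
  -- By Cartan the two undifferentiated terms add up to `lineOp` of `∂_e φ`, which is `φ`.
  rw [h₁, add_right_comm, ← lineOp_add he hc₁ (alt.continuous.comp hdψ) hc₂
    ((κ.continuous.comp alt'.continuous).comp (hφ.continuous_fderiv one_ne_zero)), hsum,
    lineOp_fderiv_apply he hc hφ, one_smul]

/-- The homotopy formula for integration of forms along the direction `e`. -/
theorem lineOp_homotopy {E : Type} [NormedAddCommGroup E] [NormedSpace ℝ E] {ℓ : E →L[ℝ] ℝ}
    {e : E} (he : ℓ e = 1) {a : ℝ → ℝ} (ha : ContDiff ℝ 1 a) {p : ℕ}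
    {φ : E → E [⋀^Fin (p + 1)]→L[ℝ] ℂ} (hc : HasCompactSupport φ) (hφ : ContDiff ℝ 1 φ) (x : E) :
    alternatizeUncurryFin (fderiv ℝ (lineOp 1 a ℓ e fun y => contractCLM e p (φ y)) x) +
      lineOp 1 a ℓ e (fun y => contractCLM e (p + 1) (alternatizeUncurryFin (fderiv ℝ φ y))) x =
    φ x + alternatizeUncurryFin
      (ℓ.smulRight (lineOp 0 (deriv a) ℓ e (fun y => contractCLM e p (φ y)) x)) :=
  lineOp_homotopy_of_cartan he ha hc hφ ((contractCLM e p).restrictScalars ℝ)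
    ((contractCLM e (p + 1)).restrictScalars ℝ) (alternatizeUncurryFinCLM ℝ E ℂ)
    (alternatizeUncurryFinCLM ℝ E ℂ) (alternatizeUncurryFin_contract_add e) x

namespace TestForm

variable {N : ℕ}

/-- A smooth function which is `0` on `(-∞, 1]` and `-1` on `[2, ∞)`. -/
def negStep (y : ℝ) : ℝ := -Real.smoothTransition (y - 1)

theorem contDiff_negStep : ContDiff ℝ (⊤ : ℕ∞) negStep :=
  (Real.smoothTransition.contDiff.comp (contDiff_id.sub contDiff_const)).neg

theorem negStep_of_le {y : ℝ} (hy : y ≤ 1) : negStep y = 0 := by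
  rw [negStep, Real.smoothTransition.zero_of_nonpos (by linarith), neg_zero]

theorem negStep_of_ge {y : ℝ} (hy : 2 ≤ y) : negStep y = -1 := by
  rw [negStep, Real.smoothTransition.one_of_one_le (by linarith)]

theorem proj_single_self (i : Fin N) :
    (EuclideanSpace.proj i : EuclideanSpace ℝ (Fin N) →L[ℝ] ℝ) (EuclideanSpace.single i 1) = 1 := by
  simp

/-- The homotopy operator `𝒟^{p+1} → 𝒟^p` integrating along the `i`-th coordinate. -/
def coordHomotopy (i : Fin N) (p : ℕ) :
    TestForm (⊤ : Opens (EuclideanSpace ℝ (Fin N))) (p + 1) →L[ℂ]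
      TestForm (⊤ : Opens (EuclideanSpace ℝ (Fin N))) p :=
  lineOpCLM _ (proj_single_self i) contDiff_negStep (fun _ => negStep_of_le)
    (fun _ => negStep_of_ge) ∘L
      TestFunction.postcompCLM (contractCLM (EuclideanSpace.single i 1) p)

theorem coordHomotopy_apply (i : Fin N) {p : ℕ}
    (φ : TestForm (⊤ : Opens (EuclideanSpace ℝ (Fin N))) (p + 1)) (x : EuclideanSpace ℝ (Fin N)) :
    coordHomotopy i p φ x = lineOp 1 negStep (EuclideanSpace.proj i) (EuclideanSpace.single i 1)
      (fun y => contractCLM (EuclideanSpace.single i 1) p (φ y)) x :=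
  congrFun (coe_lineOpCLM ..) x

variable {Ω : Opens (EuclideanSpace ℝ (Fin N))} {p : ℕ}

theorem contDiff_one (φ : TestForm Ω p) : ContDiff ℝ 1 φ :=
  φ.contDiff.of_le (by exact_mod_cast le_top)

theorem d_apply (φ : TestForm Ω p) (x : EuclideanSpace ℝ (Fin N)) :
    d Ω p φ x = alternatizeUncurryFin (fderiv ℝ φ x) := congrFun (coe_d φ) x

/-- No error term arises on functions: contracting `dφ` gives `∂_e φ`, whose full line integrals
vanish. -/
theorem coordHomotopy_d_zero (i : Fin N)
    (φ : TestForm (⊤ : Opens (EuclideanSpace ℝ (Fin N))) 0) :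
    coordHomotopy i 0 (d ⊤ 0 φ) = φ := by
  ext1 x
  simp only [coordHomotopy_apply, d_apply, contract_alternatizeUncurryFin_zero]
  rw [lineOp_fderiv_apply (proj_single_self i) φ.hasCompactSupport (contDiff_one φ), one_smul]

theorem coordHomotopy_homotopy (i : Fin N)
    (φ : TestForm (⊤ : Opens (EuclideanSpace ℝ (Fin N))) (p + 1)) (x : EuclideanSpace ℝ (Fin N)) :
    d ⊤ p (coordHomotopy i p φ) x + coordHomotopy i (p + 1) (d ⊤ (p + 1) φ) x =
      φ x + alternatizeUncurryFin ((EuclideanSpace.proj i).smulRight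
        (lineOp 0 (deriv negStep) (EuclideanSpace.proj i) (EuclideanSpace.single i 1)
          (fun y => contractCLM (EuclideanSpace.single i 1) p (φ y)) x)) := by
  have h := lineOp_homotopy (proj_single_self i)
    (contDiff_negStep.of_le (by exact_mod_cast le_top)) φ.hasCompactSupport (contDiff_one φ) x
  rw [← h, d_apply, coordHomotopy_apply]
  simp only [d_apply]
  rw [show (coordHomotopy i p φ : _ → _) = _ from funext (coordHomotopy_apply i φ)]

end TestForm
end

/-! ### Residuals of homotopies and their coefficients -/

noncomputable section

open MeasureTheory Set
open ContinuousAlternatingMap (alternatizeUncurryFin contractCLM alternatizeUncurryFin_apply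
  contractCLM_apply)

namespace TestForm

variable {N : ℕ} {Ω : Opens (EuclideanSpace ℝ (Fin N))} {p : ℕ}

/-- A family of operators `𝒟^{p+1}(ℝ^N) → 𝒟^p(ℝ^N)`. -/
abbrev Lowering (N : ℕ) : Type :=
  (p : ℕ) → TestForm (⊤ : Opens (EuclideanSpace ℝ (Fin N))) (p + 1) →L[ℂ]
    TestForm (⊤ : Opens (EuclideanSpace ℝ (Fin N))) p

/-- The chain map `1 - (dK + Kd)`. -/
def residual (K : Lowering N) : (p : ℕ) → TestForm (⊤ : Opens (EuclideanSpace ℝ (Fin N))) p →L[ℂ]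
    TestForm (⊤ : Opens (EuclideanSpace ℝ (Fin N))) p
  | 0 => .id ℂ _ - K 0 ∘L d ⊤ 0
  | p + 1 => .id ℂ _ - d ⊤ p ∘L K p - K (p + 1) ∘L d ⊤ (p + 1)

theorem residual_zero_apply (K : Lowering N) (φ) : residual K 0 φ = φ - K 0 (d ⊤ 0 φ) := rfl

theorem residual_succ_apply (K : Lowering N) (φ) :
    residual K (p + 1) φ = φ - d ⊤ p (K p φ) - K (p + 1) (d ⊤ (p + 1) φ) := rfl

theorem residual_d (K : Lowering N) (φ : TestForm (⊤ : Opens (EuclideanSpace ℝ (Fin N))) p) :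
    residual K (p + 1) (d ⊤ p φ) = d ⊤ p (residual K p φ) := by
  cases p with
  | zero => rw [residual_succ_apply, residual_zero_apply, d_d, map_zero, sub_zero, map_sub]
  | succ p =>
    rw [residual_succ_apply, residual_succ_apply, d_d, map_zero, sub_zero, map_sub, map_sub, d_d,
      sub_zero]

/-- The family of operators whose residual is the composition of those of `K` and `L`. -/
def Lowering.comp (K L : Lowering N) : Lowering N := fun p => K p + residual K p ∘L L p

/-- Write `R_K`, `R_L` for the residuals. Then `1 - R_K R_L = (1 - R_K) + R_K (1 - R_L)`, and `R_K`
commutes with `d`, so the right side is the homotopy expression of `K + R_K L`. -/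
theorem residual_comp (K L : Lowering N) (φ : TestForm (⊤ : Opens (EuclideanSpace ℝ (Fin N))) p) :
    residual (K.comp L) p φ = residual K p (residual L p φ) := by
  have h : ∀ q φ, K.comp L q φ = K q φ + residual K q (L q φ) := fun _ _ => rfl
  cases p with
  | zero =>
    rw [residual_zero_apply, h, residual_zero_apply L, map_sub, residual_zero_apply K φ]
    abel
  | succ p =>
    rw [residual_succ_apply, h, h, residual_succ_apply L, map_sub, map_sub, map_add, residual_d,
      residual_succ_apply K φ]
    abel

/-- `K` preserves the forms with compact support in `Ω`. -/
def Lowering.Preserves (K : Lowering N) (Ω : Opens (EuclideanSpace ℝ (Fin N))) : Prop :=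
  ∀ p, ∀ φ ∈ LinearMap.range (extendByZero Ω (p + 1)).toLinearMap,
    K p φ ∈ LinearMap.range (extendByZero Ω p).toLinearMap

theorem d_mem_range_extendByZero {φ : TestForm (⊤ : Opens (EuclideanSpace ℝ (Fin N))) p}
    (hφ : φ ∈ LinearMap.range (extendByZero Ω p).toLinearMap) :
    d ⊤ p φ ∈ LinearMap.range (extendByZero Ω (p + 1)).toLinearMap := by
  obtain ⟨ψ, rfl⟩ := hφ
  exact ⟨d Ω p ψ, extendByZero_d ψ⟩

theorem Lowering.Preserves.residual_mem {K : Lowering N} (hK : K.Preserves Ω)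
    {φ : TestForm (⊤ : Opens (EuclideanSpace ℝ (Fin N))) p}
    (hφ : φ ∈ LinearMap.range (extendByZero Ω p).toLinearMap) :
    residual K p φ ∈ LinearMap.range (extendByZero Ω p).toLinearMap := by
  cases p with
  | zero => exact sub_mem hφ (hK _ _ (d_mem_range_extendByZero hφ))
  | succ p =>
    exact sub_mem (sub_mem hφ (d_mem_range_extendByZero (hK _ _ hφ)))
      (hK _ _ (d_mem_range_extendByZero hφ))

theorem Lowering.Preserves.comp {K L : Lowering N} (hK : K.Preserves Ω) (hL : L.Preserves Ω) :
    (K.comp L).Preserves Ω := fun _ _ hφ =>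
  add_mem (hK _ _ hφ) (hK.residual_mem (hL _ _ hφ))

/-- The value of a form on the basis vectors of indices `r₀, …, r_{p-1}`. -/
def coeff (r : Fin p → Fin N) (ω : EuclideanSpace ℝ (Fin N) [⋀^Fin p]→L[ℝ] ℂ) : ℂ :=
  ω fun k => EuclideanSpace.single (r k) 1

theorem eq_zero_of_coeff {ω : EuclideanSpace ℝ (Fin N) [⋀^Fin p]→L[ℝ] ℂ}
    (h : ∀ r, coeff r ω = 0) : ω = 0 := by
  refine ContinuousAlternatingMap.toAlternatingMap_injective
    (AlternatingMap.ext_iff.2 fun v => ?_)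
  have := Module.Basis.ext_alternating (f := ω.toAlternatingMap) (g := 0)
    (EuclideanSpace.basisFun (Fin N) ℝ).toBasis fun r _ => by simpa [coeff] using h r
  exact congrArg (· v) this

theorem residual_coordHomotopy_succ (i : Fin N)
    (φ : TestForm (⊤ : Opens (EuclideanSpace ℝ (Fin N))) (p + 1)) (x : EuclideanSpace ℝ (Fin N)) :
    residual (coordHomotopy i) (p + 1) φ x = -alternatizeUncurryFin
      ((EuclideanSpace.proj i).smulRight (lineOp 0 (deriv negStep) (EuclideanSpace.proj i)
        (EuclideanSpace.single i 1)
        (fun y => contractCLM (EuclideanSpace.single i 1) p (φ y)) x)) := by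
  have h := coordHomotopy_homotopy i φ x
  rw [← sub_eq_iff_eq_add'] at h
  rw [← h]
  change φ x - d ⊤ p (coordHomotopy i p φ) x - coordHomotopy i (p + 1) (d ⊤ (p + 1) φ) x = _
  abel

theorem coeff_residual_coordHomotopy_succ (i : Fin N)
    (φ : TestForm (⊤ : Opens (EuclideanSpace ℝ (Fin N))) (p + 1)) (x : EuclideanSpace ℝ (Fin N))
    (r : Fin (p + 1) → Fin N) :
    coeff r (residual (coordHomotopy i) (p + 1) φ x) = -∑ k : Fin (p + 1), (-1 : ℤ) ^ (k : ℕ) •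
      (EuclideanSpace.single (r k) (1 : ℝ) i • lineOp 0 (deriv negStep) (EuclideanSpace.proj i)
        (EuclideanSpace.single i 1) (fun y => coeff (Matrix.vecCons i (k.removeNth r)) (φ y)) x) := by
  rw [residual_coordHomotopy_succ, coeff, ContinuousAlternatingMap.neg_apply, alternatizeUncurryFin_apply, neg_inj]
  refine Finset.sum_congr rfl fun k _ => ?_
  set v : Fin p → EuclideanSpace ℝ (Fin N) :=
    k.removeNth fun k => EuclideanSpace.single (r k) (1 : ℝ) with hv
  have hψ : HasCompactSupport fun y => contractCLM (EuclideanSpace.single i 1) p (φ y) :=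
    φ.hasCompactSupport.comp_left (map_zero _)
  -- Contraction followed by evaluation on basis vectors is linear, so it passes through the line
  -- integral.
  have h := lineOp_comp (c := 0) (a := deriv negStep) (proj_single_self i) hψ
    ((contractCLM (EuclideanSpace.single i 1) p).continuous.comp φ.continuous)
    (ContinuousAlternatingMap.apply ℝ _ ℂ v) x
  have hcoeff : ∀ y, coeff (Matrix.vecCons i (k.removeNth r)) (φ y) =
      ContinuousAlternatingMap.apply ℝ _ ℂ v (contractCLM (EuclideanSpace.single i 1) p (φ y)) := by
    intro y
    refine congrArg (φ y) (funext (Fin.cases rfl fun l => rfl))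
  simp only [hcoeff, h]
  rfl

theorem coeff_residual_coordHomotopy_of_notMem (i : Fin N)
    (φ : TestForm (⊤ : Opens (EuclideanSpace ℝ (Fin N))) p) (x : EuclideanSpace ℝ (Fin N))
    {r : Fin p → Fin N} (hr : i ∉ range r) : coeff r (residual (coordHomotopy i) p φ x) = 0 := by
  cases p with
  | zero =>
    rw [residual_zero_apply, coordHomotopy_d_zero, sub_self]
    rfl
  | succ p =>
    rw [coeff_residual_coordHomotopy_succ, neg_eq_zero]
    refine Finset.sum_eq_zero fun k _ => ?_
    have : i ≠ r k := fun h => hr ⟨k, h.symm⟩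
    simp [this]

/-- If the coefficients `φ_r` vanish for all `r` omitting `j`, then so do those of the residual
of `φ`. -/
theorem coeff_residual_coordHomotopy (i : Fin N) {j : Fin N}
    {φ : TestForm (⊤ : Opens (EuclideanSpace ℝ (Fin N))) p}
    (hφ : ∀ x (r : Fin p → Fin N), j ∉ range r → coeff r (φ x) = 0)
    (x : EuclideanSpace ℝ (Fin N))
    {r : Fin p → Fin N} (hr : j ∉ range r) : coeff r (residual (coordHomotopy i) p φ x) = 0 := by
  cases p with
  | zero => exact coeff_residual_coordHomotopy_of_notMem i φ x (by simp)
  | succ p =>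
    rw [coeff_residual_coordHomotopy_succ, neg_eq_zero]
    refine Finset.sum_eq_zero fun k _ => ?_
    -- If `r k = i`, the tuple with `i` moved to the front has the same entries as `r`, so it still
    -- omits `j`; otherwise the factor `dx_i` gives `0`.
    by_cases hk : r k = i
    · rw [lineOp_eq_zero_of_line, smul_zero, smul_zero]
      refine fun s => hφ _ _ ?_
      rintro ⟨l, hl⟩
      induction l using Fin.cases with
      | zero => exact hr ⟨k, hk.trans hl⟩
      | succ l => exact hr ⟨_, hl⟩
    · simp [Ne.symm hk]

/-! ### Supports in the half-space and the global homotopy -/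

section HalfSpace

variable {n : ℕ}

/-- A nonempty compact support attains a positive minimal height. The bound `b ≤ 1` makes `negStep`
vanish below `b`. -/
theorem mem_range_extendByZero_halfSpace_iff
    {φ : TestForm (⊤ : Opens (EuclideanSpace ℝ (Fin (n + 1)))) p} :
    φ ∈ LinearMap.range (extendByZero (halfSpace n) p).toLinearMap ↔
      ∃ b : ℝ, 0 < b ∧ b ≤ 1 ∧ ∀ x, x (Fin.last n) < b → φ x = 0 := by
  constructor
  · rintro ⟨ψ, rfl⟩
    change ∃ b : ℝ, 0 < b ∧ b ≤ 1 ∧ ∀ x, x (Fin.last n) < b → (extendByZero (halfSpace n) p ψ) x = 0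
    rw [coe_extendByZero]
    obtain h | h := (tsupport ψ).eq_empty_or_nonempty
    · exact ⟨1, one_pos, le_rfl, fun x _ => image_eq_zero_of_notMem_tsupport (by simp [h])⟩
    obtain ⟨y, hy, hmin⟩ := IsCompact.exists_isMinOn ψ.hasCompactSupport h
      (f := fun x => x (Fin.last n)) (by fun_prop)
    refine ⟨min 1 (y (Fin.last n)), lt_min one_pos (ψ.tsupport_subset hy), min_le_left _ _,
      fun x hx => image_eq_zero_of_notMem_tsupport fun hx' => ?_⟩
    exact absurd (hmin hx') (not_le.2 (hx.trans_le (min_le_right _ _)))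
  · rintro ⟨b, hb, -, h⟩
    refine ⟨⟨φ, φ.contDiff, φ.hasCompactSupport, ?_⟩, DFunLike.coe_injective (coe_extendByZero _)⟩
    have hcl : IsClosed {x : EuclideanSpace ℝ (Fin (n + 1)) | b ≤ x (Fin.last n)} :=
      isClosed_le continuous_const (by fun_prop)
    refine (closure_minimal (fun x hx => ?_) hcl).trans fun x hx => hb.trans_le hx
    by_contra! hlt
    exact hx (h x (not_le.1 hlt))

/-- Horizontal lines stay at constant height; vertical integration starts from below. -/
theorem preserves_coordHomotopy (i : Fin (n + 1)) :
    Lowering.Preserves (coordHomotopy i) (halfSpace n) := by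
  intro p φ hφ
  rw [mem_range_extendByZero_halfSpace_iff] at hφ ⊢
  obtain ⟨b, hb, hb1, h⟩ := hφ
  refine ⟨b, hb, hb1, fun x hx => ?_⟩
  rw [coordHomotopy_apply]
  by_cases hi : i = Fin.last n
  · subst hi
    exact lineOp_eq_zero_of_lt (proj_single_self _) (negStep_of_le (hx.le.trans hb1))
      (fun y hy => by rw [h y hy, map_zero]) hx
  · refine lineOp_eq_zero_of_line fun s => ?_
    rw [h, map_zero]
    simpa [Ne.symm hi] using hx

/-- Each new residual is applied last: it kills the coefficients omitting its own index and keeps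
the vanishing already obtained. -/
theorem exists_lowering (n m : ℕ) (hm : m ≤ n + 1) :
    ∃ K : Lowering (n + 1), K.Preserves (halfSpace n) ∧
      ∀ (p : ℕ) (φ : TestForm (⊤ : Opens (EuclideanSpace ℝ (Fin (n + 1)))) p) (j : Fin (n + 1)),
        j.1 < m → ∀ x (r : Fin p → Fin (n + 1)), j ∉ range r → coeff r (residual K p φ x) = 0 := by
  induction m with
  | zero => exact ⟨fun _ => 0, fun _ _ _ => zero_mem _, fun _ _ _ hj => absurd hj (Nat.not_lt_zero _)⟩
  | succ m ih =>
    obtain ⟨K, hK, h⟩ := ih (by omega)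
    refine ⟨Lowering.comp (coordHomotopy ⟨m, hm⟩) K, (preserves_coordHomotopy _).comp hK,
      fun p φ j hj x r hr => ?_⟩
    rw [residual_comp]
    rcases Nat.lt_succ_iff_lt_or_eq.1 hj with hj | hj
    · exact coeff_residual_coordHomotopy _ (h p φ j hj) x hr
    · obtain rfl : j = ⟨m, hm⟩ := Fin.ext hj
      exact coeff_residual_coordHomotopy_of_notMem _ _ x hr

/-- A homotopy from the identity to `0` in degrees `p ≤ n`, preserving the forms with compact
support in the half-space. -/
theorem exists_lowering_residual_eq_zero (n : ℕ) :
    ∃ K : Lowering (n + 1), K.Preserves (halfSpace n) ∧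
      ∀ p ≤ n, ∀ φ, residual K p φ = 0 := by
  obtain ⟨K, hK, h⟩ := exists_lowering n (n + 1) le_rfl
  refine ⟨K, hK, fun p hp φ => TestFunction.ext fun x => eq_zero_of_coeff fun r => ?_⟩
  -- At most `n` slots cannot exhaust `n + 1` indices.
  obtain ⟨j, hj⟩ : ∃ j, j ∉ range r := by
    by_contra! hr
    have := Fintype.card_le_of_surjective r hr
    simp at this
    omega
  exact h p φ j j.2 x r hj

end HalfSpace

end TestForm

/-! ### Transposing the homotopy to currents -/

theorem Current.exists_d_eq (n k : ℕ) (T : Current (halfSpace n) (k + 1)) (hT : T ∈ Current.extensible (halfSpace n) (k + 1))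
    (hd : Current.d (halfSpace n) (k + 1) T = 0) :
    ∃ S ∈ Current.extensible (halfSpace n) k, Current.d (halfSpace n) k S = T := by
  obtain ⟨K, hK, hres⟩ := TestForm.exists_lowering_residual_eq_zero n
  obtain ⟨T', rfl⟩ := hT
  -- `T'` need not be closed on the whole space; it only annihilates `dφ` for `φ` supported in the
  -- half-space. This suffices because `K` preserves such forms.
  have hclosed : ∀ (q : ℕ) (hq : q + 1 + (k + 1) = n + 1),
      ∀ φ ∈ LinearMap.range (TestForm.extendByZero (halfSpace n) q).toLinearMap,
        T'.eval hq (TestForm.d ⊤ q φ) = 0 := by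
    rintro q hq _ ⟨ψ, rfl⟩
    have h := congrArg (fun S => Current.eval S (by omega : q + (k + 1 + 1) = n + 1) ψ) hd
    simp only [Current.eval_d, Current.eval_restrict, TestForm.extendByZero_d] at h
    exact (mul_eq_zero.1 h).resolve_left (pow_ne_zero _ (by norm_num))
  let S' : Current (⊤ : Opens (EuclideanSpace ℝ (Fin (n + 1)))) k := fun q =>
    match q with
    -- The default value is harmless: `dS'` only evaluates `S'` on forms of degree at least `1`.
    | ⟨0, _⟩ => 0
    | ⟨p + 1, hp⟩ => (-1 : ℂ) ^ (k + 1) • (T' ⟨p, by omega⟩ ∘L K p)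
  refine ⟨Current.restrict _ k S', ⟨S', rfl⟩, Current.ext fun p hp φ => ?_⟩
  set χ := TestForm.extendByZero (halfSpace n) p φ with hχ
  have hχm : χ ∈ LinearMap.range (TestForm.extendByZero (halfSpace n) p).toLinearMap := ⟨φ, rfl⟩
  rw [Current.d_restrict, Current.eval_restrict, Current.eval_restrict, Current.eval_d, ← hχ]
  have hS : S'.eval (by omega : p + 1 + k = n + 1) (TestForm.d ⊤ p χ) =
      (-1) ^ (k + 1) * T'.eval hp (K p (TestForm.d ⊤ p χ)) := rfl
  rw [hS, ← mul_assoc, ← mul_pow]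
  norm_num
  -- Positivity of the degree `k + 1` of `T` forces `p ≤ n`, the range where the residual vanishes.
  have h0 := hres p (by omega) χ
  cases p with
  | zero =>
    rw [TestForm.residual_zero_apply, sub_eq_zero] at h0
    rw [← h0]
  | succ p =>
    rw [TestForm.residual_succ_apply, sub_sub, sub_eq_zero] at h0
    conv_rhs => rw [h0]
    have hz := hclosed p hp _ (hK p χ hχm)
    have hadd : ∀ α β, T'.eval hp (α + β) = T'.eval hp α + T'.eval hp β := fun α β =>
      map_add (T' ⟨_, hp⟩) α β
    rw [hadd, hz, zero_add]

end

theorem mainTheorem4 (n : ℕ) :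
    (∀ j : ℕ, 1 ≤ j → j ≤ n + 1 →
      Subsingleton (Current.ExtensibleCohomology (halfSpace n) j)) ∧
    (∀ k : ℕ, k + 1 ≤ n + 1 → ∀ T ∈ Current.extensible (halfSpace n) (k + 1),
      Current.d (halfSpace n) (k + 1) T = 0 →
        ∃ S ∈ Current.extensible (halfSpace n) k, Current.d (halfSpace n) k S = T) := by
  refine ⟨fun j hj _ => ?_, fun k _ => Current.exists_d_eq n k⟩
  obtain ⟨k, rfl⟩ : ∃ k, j = k + 1 := ⟨j - 1, by omega⟩
  rw [Submodule.Quotient.subsingleton_iff, Submodule.submoduleOf_eq_top]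
  rintro T ⟨hT, hd⟩
  exact Current.exists_d_eq n k T hT hd
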